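/- Let $G$ be the $5$-dimensional simply connected nilpotent Lie group with underlying manifold $\mathbb R^5$ and multiplication \[ (x_1,\dots,x_5)(y_1,\dots,y_5)=\bigl(x_1+y_1,\ x_2+y_2,\ x_3+y_3+\tfrac12(x_1y_2-x_2y_1),\ x_4+y_4,\ x_5+y_5+\tfrac12(x_1y_4-x_4y_1)\bigr) \] (it is the indecomposable group whose Lie algebra has a basis $e_1,\dots,e_5$ whose only non-zero brackets are $[e_1,e_2]=e_3$ and $[e_1,e_4]=e_5$, up to antisymmetry; its $2$-dimensional centre equals its commutator subgroup). A loop is a set $L$ with a multiplication that has a two-sided identity and for which each of the equations $a\cdot y=b$ and $x\cdot a=b$ has exactly one solution, $y=a\backslash b$ and $x=b/a$; it is proper if the multiplication is not associative, and topological if $L$ is a topological space and multiplication and both divisions are continuous on $L\times L$. There is no proper topological loop $L$ on a connected $3$-dimensional topological manifold (a connected space locally homeomorphic to $\mathbb R^3$) having $G$ as its multiplication group. This holds in both usual senses of the term: $G$ is not isomorphic, even as an abstract group, to the group of permutations of $L$ generated by all left translations $y\mapsto a\cdot y$ and all right translations $y\mapsto y\cdot a$ $(a\in L)$; and $G$ is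 not isomorphic, as a topological group, to the group topologically generated by these translations, that is, the smallest closed subgroup containing them of the group of homeomorphisms of $L$, with the topology of uniform convergence on compact sets of a homeomorphism and of its inverse (on a manifold, the compact-open topology). -/

import Mathlib

open scoped Manifold ContDiff

/-- A loop: a multiplication with a two-sided identity `1` such that each of the equations
`a * y = b` and `x * a = b` has exactly one solution, `y = ldiv a b` and `x = rdiv b a`. -/
class LoopAlg (L : Type*) extends MulOneClass L where
  /-- `ldiv a b` is the left quotient, `a \ b`. -/
  ldiv : L → L → L
  /-- `rdiv b a` is the right quotient, `b / a`. -/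
  rdiv : L → L → L
  mul_ldiv : ∀ a b : L, a * ldiv a b = b
  ldiv_mul : ∀ a b : L, ldiv a (a * b) = b
  rdiv_mul : ∀ a b : L, rdiv b a * a = b
  mul_rdiv : ∀ a b : L, rdiv (b * a) a = b

/-- A topological loop: the multiplication and both divisions are continuous on `L × L`. -/
class TopologicalLoop (L : Type*) [TopologicalSpace L] [LoopAlg L] : Prop where
  continuous_mul : Continuous fun p : L × L => p.1 * p.2
  continuous_ldiv : Continuous fun p : L × L => LoopAlg.ldiv p.1 p.2
  continuous_rdiv : Continuous fun p : L × L => LoopAlg.rdiv p.1 p.2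

/-- A loop is proper if it is not a group, that is, if its multiplication is not associative. -/
def IsProperLoop (L : Type*) [LoopAlg L] : Prop :=
  ¬ ∀ x y z : L, (x * y) * z = x * (y * z)

section Translations

variable (L : Type*) [LoopAlg L]

/-- The left translation `y ↦ a * y`. -/
def leftTranslation {L : Type*} [LoopAlg L] (a : L) : Equiv.Perm L where
  toFun y := a * y
  invFun y := LoopAlg.ldiv a y
  left_inv y := LoopAlg.ldiv_mul a y
  right_inv y := LoopAlg.mul_ldiv a y

/-- The right translation `y ↦ y * a`. -/
def rightTranslation {L : Type*} [LoopAlg L] (a : L) : Equiv.Perm L where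
  toFun y := y * a
  invFun y := LoopAlg.rdiv y a
  left_inv y := LoopAlg.mul_rdiv a y
  right_inv y := LoopAlg.rdiv_mul a y

/-- The multiplication group of a loop: the group of permutations of `L` generated by all left
and right translations. -/
def multGroup : Subgroup (Equiv.Perm L) :=
  Subgroup.closure (Set.range leftTranslation ∪ Set.range rightTranslation)

variable [TopologicalSpace L]

/-- The topology on the group of self-homeomorphisms: uniform convergence on compact sets of a
homeomorphism and of its inverse, i.e. the coarsest topology for which `f ↦ f` and `f ↦ f⁻¹` are
continuous into the space of continuous maps with the compact-open topology. On a manifold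
this is just the compact-open topology. -/
instance homeoTopology (X : Type*) [TopologicalSpace X] : TopologicalSpace (X ≃ₜ X) :=
  TopologicalSpace.induced (fun f => ((f : C(X, X)), (f.symm : C(X, X)))) inferInstance

/-- The group topologically generated by all left and right translations of a topological loop:
the smallest closed subgroup of the homeomorphism group of `L` that contains them. -/
def topMultGroup : Subgroup (L ≃ₜ L) :=
  sInf {K : Subgroup (L ≃ₜ L) | IsClosed (K : Set (L ≃ₜ L)) ∧
    ∀ f : L ≃ₜ L, (∃ a : L, f.toEquiv = leftTranslation a ∨ f.toEquiv = rightTranslation a) →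
      f ∈ K}

end Translations

/-- The underlying manifold `ℝ⁵` of the simply connected Lie group with Lie algebra
`[e₁, e₂] = e₃`, `[e₁, e₄] = e₅`. The coordinates `x₁, …, x₅` are `x 0, …, x 4`. -/
def NilGroup5 : Type := Fin 5 → ℝ

namespace NilGroup5

instance : TopologicalSpace NilGroup5 := inferInstanceAs (TopologicalSpace (Fin 5 → ℝ))

instance : ChartedSpace (Fin 5 → ℝ) NilGroup5 :=
  inferInstanceAs (ChartedSpace (Fin 5 → ℝ) (Fin 5 → ℝ))

/-- The multiplication of the group, in exponential coordinates. -/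
noncomputable def mulFun (x y : Fin 5 → ℝ) : Fin 5 → ℝ :=
  ![x 0 + y 0,
    x 1 + y 1,
    x 2 + y 2 + (1 / 2) * (x 0 * y 1 - x 1 * y 0),
    x 3 + y 3,
    x 4 + y 4 + (1 / 2) * (x 0 * y 3 - x 3 * y 0)]

noncomputable instance : Mul NilGroup5 := ⟨mulFun⟩

instance : One NilGroup5 := ⟨fun _ => (0 : ℝ)⟩

instance : Inv NilGroup5 := ⟨fun x i => -x i⟩

noncomputable instance : Group NilGroup5 :=
  Group.ofLeftAxioms
    (by
      intro x y z
      change mulFun (mulFun x y) z = mulFun x (mulFun y z)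
      funext i
      fin_cases i <;> simp [mulFun] <;> ring)
    (by
      intro x
      change mulFun (fun _ => 0) x = x
      funext i
      fin_cases i <;> simp [mulFun])
    (by
      intro x
      change mulFun (fun i => -x i) x = fun _ => 0
      funext i
      fin_cases i <;> simp [mulFun] <;> ring)

/-- The group is a real-analytic Lie group of dimension five. -/
instance : LieGroup 𝓘(ℝ, Fin 5 → ℝ) ω NilGroup5 where
  toIsManifold := inferInstanceAs (IsManifold 𝓘(ℝ, Fin 5 → ℝ) ω (Fin 5 → ℝ))
  contMDiff_mul := by
    have h : ContDiff ℝ ω fun p : (Fin 5 → ℝ) × (Fin 5 → ℝ) => mulFun p.1 p.2 := by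
      rw [contDiff_pi]
      intro i
      fin_cases i <;> simp [mulFun] <;> fun_prop
    have h' := h.contMDiff
    rw [modelWithCornersSelf_prod, ← chartedSpaceSelf_prod] at h'
    exact h'
  contMDiff_inv := by
    have h : ContDiff ℝ ω fun (p : Fin 5 → ℝ) (i : Fin 5) => -p i := by fun_prop
    exact h.contMDiff

end NilGroup5

/-! The obstruction is purely algebraic: the given group is nilpotent of class 2. If it is the
multiplication group, the commutator of a left translation by `x` and a right translation by `z` is
central. Suitably arranged, it also fixes the identity. A central element of a transitive
permutation group that fixes a point is trivial, so left and right translations commute, which is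
associativity. -/

open scoped commutatorElement

/-- Commutators in `NilGroup5` are central. -/
theorem NilGroup5.commute_commutatorElement (x y z : NilGroup5) : Commute ⁅x, y⁆ z := by
  have h : x * y * x⁻¹ * y⁻¹ * z = z * (x * y * x⁻¹ * y⁻¹) := by
    change mulFun (mulFun (mulFun (mulFun x y) fun i => -x i) fun i => -y i) z =
      mulFun z (mulFun (mulFun (mulFun x y) fun i => -x i) fun i => -y i)
    funext i
    fin_cases i <;> simp [mulFun] <;> ring
  exact h

/-- If a group whose commutators are central acts on a loop in such a way that all translations
come from the action, then the loop is associative: the commutator of a left and a right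
translation fixes the identity and commutes with all left translations, hence is trivial. -/
theorem LoopAlg.mul_assoc_of_commute_commutatorElement {L Γ : Type*} [LoopAlg L] [Group Γ]
    (φ : Γ →* Equiv.Perm L) (hΓ : ∀ g h k : Γ, Commute ⁅g, h⁆ k)
    (hl : ∀ a : L, ∃ g, φ g = leftTranslation a) (hr : ∀ a : L, ∃ g, φ g = rightTranslation a)
    (x y z : L) : (x * y) * z = x * (y * z) := by
  obtain ⟨g, hg⟩ := hl x
  obtain ⟨h, hh⟩ := hr z
  -- The inverses are placed so that the orbit of the identity closes up: 1 ↦ z ↦ xz ↦ (xz)/z = x ↦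
  -- x\x = 1.
  have hfix : φ ⁅g⁻¹, h⁻¹⁆ 1 = 1 := by
    rw [map_commutatorElement, map_inv, map_inv, hg, hh, commutatorElement_def, inv_inv, inv_inv]
    change LoopAlg.ldiv x (LoopAlg.rdiv (x * (1 * z)) z) = 1
    rw [one_mul, LoopAlg.mul_rdiv]
    simpa only [mul_one] using LoopAlg.ldiv_mul x 1
  -- Left translations already act transitively, since each `a` is the image of 1; centrality
  -- carries the fixed point 1 to `a`.
  have htriv : φ ⁅g⁻¹, h⁻¹⁆ = 1 := by
    ext a
    obtain ⟨k, hk⟩ := hl a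
    have hka : φ k 1 = a := by
      rw [hk]
      exact mul_one a
    have hcomm := DFunLike.congr_fun ((hΓ g⁻¹ h⁻¹ k).map φ).eq (1 : L)
    rwa [Equiv.Perm.mul_apply, Equiv.Perm.mul_apply, hfix, hka] at hcomm
  rw [map_commutatorElement, commutatorElement_eq_one_iff_commute, map_inv, map_inv,
    Commute.inv_inv_iff, hg, hh] at htriv
  exact (DFunLike.congr_fun htriv.eq y).symm

/-- The left translations of a topological loop are homeomorphisms. -/
def leftTranslationHomeomorph {L : Type*} [TopologicalSpace L] [LoopAlg L] [TopologicalLoop L]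
    (a : L) : L ≃ₜ L where
  toEquiv := leftTranslation a
  continuous_toFun := TopologicalLoop.continuous_mul.comp (Continuous.prodMk_right a)
  continuous_invFun := TopologicalLoop.continuous_ldiv.comp (Continuous.prodMk_right a)

/-- The right translations of a topological loop are homeomorphisms. -/
def rightTranslationHomeomorph {L : Type*} [TopologicalSpace L] [LoopAlg L] [TopologicalLoop L]
    (a : L) : L ≃ₜ L where
  toEquiv := rightTranslation a
  continuous_toFun := TopologicalLoop.continuous_mul.comp (Continuous.prodMk_left a)
  continuous_invFun := TopologicalLoop.continuous_rdiv.comp (Continuous.prodMk_left a)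

/-- The homomorphism that forgets the continuity of a self-homeomorphism. -/
def homeomorphToPerm (X : Type*) [TopologicalSpace X] : (X ≃ₜ X) →* Equiv.Perm X where
  toFun f := f.toEquiv
  map_one' := rfl
  map_mul' _ _ := rfl

theorem leftTranslationHomeomorph_mem_topMultGroup {L : Type*} [TopologicalSpace L] [LoopAlg L]
    [TopologicalLoop L] (a : L) : leftTranslationHomeomorph a ∈ topMultGroup L :=
  Subgroup.mem_sInf.2 fun _ hK => hK.2 _ ⟨a, Or.inl rfl⟩

theorem rightTranslationHomeomorph_mem_topMultGroup {L : Type*} [TopologicalSpace L] [LoopAlg L]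
    [TopologicalLoop L] (a : L) : rightTranslationHomeomorph a ∈ topMultGroup L :=
  Subgroup.mem_sInf.2 fun _ hK => hK.2 _ ⟨a, Or.inr rfl⟩

theorem mainTheorem8 (L : Type*) [TopologicalSpace L]
    [ChartedSpace (EuclideanSpace ℝ (Fin 3)) L] [ConnectedSpace L]
    [LoopAlg L] [TopologicalLoop L] (hL : IsProperLoop L) :
    IsEmpty (NilGroup5 ≃* multGroup L) ∧ IsEmpty (NilGroup5 ≃ₜ* topMultGroup L) := by
  refine ⟨⟨fun e => hL ?_⟩, ⟨fun e => hL ?_⟩⟩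
  · refine LoopAlg.mul_assoc_of_commute_commutatorElement
      ((multGroup L).subtype.comp e.toMonoidHom) NilGroup5.commute_commutatorElement
      (fun a => ?_) (fun a => ?_)
    · exact ⟨e.symm ⟨leftTranslation a, Subgroup.subset_closure (Or.inl ⟨a, rfl⟩)⟩, by simp⟩
    · exact ⟨e.symm ⟨rightTranslation a, Subgroup.subset_closure (Or.inr ⟨a, rfl⟩)⟩, by simp⟩
  -- Any elements added by taking the closure are harmless: the lemma only asks that the
  -- translations lie in the image of the action.
  · refine LoopAlg.mul_assoc_of_commute_commutatorElement
      ((homeomorphToPerm L).comp ((topMultGroup L).subtype.comp e.toMulEquiv.toMonoidHom))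
      NilGroup5.commute_commutatorElement (fun a => ?_) (fun a => ?_)
    · refine ⟨e.toMulEquiv.symm ⟨_, leftTranslationHomeomorph_mem_topMultGroup a⟩, ?_⟩
      simp only [MonoidHom.comp_apply, MulEquiv.toMonoidHom_eq_coe, MonoidHom.coe_coe,
        MulEquiv.apply_symm_apply]
      rfl
    · refine ⟨e.toMulEquiv.symm ⟨_, rightTranslationHomeomorph_mem_topMultGroup a⟩, ?_⟩
      simp only [MonoidHom.comp_apply, MulEquiv.toMonoidHom_eq_coe, MonoidHom.coe_coe,
        MulEquiv.apply_symm_apply]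
      rfl
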